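/- Theorem 1.3 (Generalized Tchakaloff Theorem, real case). Let $d\ge 0$ and $n\ge 1$ be integers. For an integer $m\ge 0$, let $\mathbb{R}_{m,d}[t]$ denote the space of real polynomials in $t=(t_1,\dots,t_d)$ of total degree at most $m$. Let $\mu$ be a positive Borel measure on $\mathbb{R}^d$ having convergent moments up to at least degree $n$, that is, every $p\in\mathbb{R}_{n,d}[t]$ is absolutely integrable with respect to $\mu$. Let $\operatorname{supp}\mu$ be the closed support of $\mu$, and let $$N_{n-1,d;\mu}:=\dim\{\,p|_{\operatorname{supp}\mu} : p\in\mathbb{R}_{n-1,d}[t]\,\}.$$ Then $\mu$ has a quadrature rule of degree $n-1$ with size at most $1+N_{n-1,d;\mu}$; that is, there exist an integer $0\le N\le 1+N_{n-1,d;\mu}$, nodes $x_1,\dots,x_N\in\operatorname{supp}\mu$ and positive weights $\rho_1,\dots,\rho_N$ such that $$\int p(t)\,d\mu(t)=\sum_{k=1}^{N}\rho_k\,p(x_k)\qquad\text{for all } p\in\mathbb{R}_{n-1,d}[t].$$ (For $\mu=0$ the rule is empty, $N=0$.) -/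

import Mathlib

open MeasureTheory

noncomputable section

namespace Tchakaloff

/-- `ℝ_{m,d}[t] ⊆ L¹(μ)`: every real polynomial in `d` variables of total degree at most `m`
is absolutely integrable with respect to `μ`, that is, `μ` has convergent moments up to at
least degree `m`. -/
def HasMomentsUpTo {d : ℕ} (μ : Measure (Fin d → ℝ)) (m : ℕ) : Prop :=
  ∀ p : MvPolynomial (Fin d) ℝ, p.totalDegree ≤ m →
    Integrable (fun t => MvPolynomial.eval t p) μ

/-- The linear map `p ↦ p|_K` from polynomials to real functions on `K`. -/
def restrictTo {d : ℕ} (K : Set (Fin d → ℝ)) : MvPolynomial (Fin d) ℝ →ₗ[ℝ] (K → ℝ) where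
  toFun p := fun t => MvPolynomial.eval (t : Fin d → ℝ) p
  map_add' p q := by
    funext t
    simp
  map_smul' c p := by
    funext t
    simp [MvPolynomial.smul_eval]

/-- The space `{p|_{supp μ} : p ∈ ℝ_{m,d}[t]}`, where `supp μ` is the closed support. -/
def polyOnSupport {d : ℕ} (μ : Measure (Fin d → ℝ)) (m : ℕ) : Submodule ℝ (μ.support → ℝ) :=
  (MvPolynomial.restrictTotalDegree (Fin d) ℝ m).map (restrictTo μ.support)

/-- This space is finite-dimensional, so that its `finrank` is its true dimension. -/
instance {d : ℕ} (μ : Measure (Fin d → ℝ)) (m : ℕ) : Module.Finite ℝ (polyOnSupport μ m) := by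
  unfold polyOnSupport
  infer_instance

/-- `N_{m,d;μ} = dim {p|_{supp μ} : p ∈ ℝ_{m,d}[t]}`. -/
def dimOnSupport {d : ℕ} (μ : Measure (Fin d → ℝ)) (m : ℕ) : ℕ :=
  Module.finrank ℝ (polyOnSupport μ m)

/-- The nodes `x₁, …, x_N` and weights `ρ₁, …, ρ_N` form a quadrature rule for `μ` of degree
(precision) `m` and size `N`. The polynomials of degree at most `m` are required to be
integrable, so that the integral in the last field is never a default value. -/
structure IsQuadratureRule {d : ℕ} (μ : Measure (Fin d → ℝ)) (m : ℕ) {N : ℕ}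
    (x : Fin N → (Fin d → ℝ)) (ρ : Fin N → ℝ) : Prop where
  hasMoments : HasMomentsUpTo μ m
  node_mem : ∀ k, x k ∈ μ.support
  weight_pos : ∀ k, 0 < ρ k
  integral_eq : ∀ p : MvPolynomial (Fin d) ℝ, p.totalDegree ≤ m →
    ∫ t, MvPolynomial.eval t p ∂μ = ∑ k, ρ k * MvPolynomial.eval (x k) p

end Tchakaloff

end

/-!
The measure `μ` is finite because the constant `1` is integrable. Lift a basis of the space of
restrictions to polynomials `P i`, and let `F t = (P i (t))ᵢ`. If `μ ≠ 0`, it suffices to write the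
`μ`-average of `F` as a positive combination, with few terms, of points of `F '' μ.support`:
every polynomial of the given degree agrees on the support, hence almost everywhere, with a linear
functional of `F`.

The support need not be compact, so `F '' μ.support` and its convex hull need not be closed, and the
usual statement that an average lies in the *closed* convex hull is not enough. In finite dimension
the average does lie in the convex hull itself (`integral_mem_convexHull`). Otherwise, by
`Convex.exists_ne_zero_forall_le_of_notMem`, some nonzero functional attains at the average an upper
bound of its values on the hull; a function with an upper bound as its average equals that bound
almost everywhere, so `F` lives almost everywhere on a hyperplane through the average, and
induction on the dimension applies. Carathéodory's theorem then gives affinely independent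
nodes, of which there are at most the dimension plus one.
-/

open MeasureTheory Module

/-- A convex set in a finite-dimensional space is supported at any point outside it, also
at a point of its closure. -/
theorem Convex.exists_ne_zero_forall_le_of_notMem {E : Type*} [NormedAddCommGroup E]
    [NormedSpace ℝ E] [FiniteDimensional ℝ E] {s : Set E} (hs : Convex ℝ s) (hne : s.Nonempty)
    {x : E} (hx : x ∉ s) : ∃ f : StrongDual ℝ E, f ≠ 0 ∧ ∀ y ∈ s, f y ≤ f x := by
  by_cases hint : (interior s).Nonempty
  · obtain ⟨f, u, hf, hfs, hfx⟩ := geometric_hahn_banach_of_nonempty_interior hs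
      (convex_singleton x)
      (Set.disjoint_singleton_right.2 fun h => hx (interior_subset h)) hint
      (Set.singleton_nonempty x)
    exact ⟨f, hf, fun y hy => (hfs y hy).trans (hfx x rfl)⟩
  -- A flat set lies in a hyperplane, whose equation can be used with either sign.
  · obtain ⟨y₀, hy₀⟩ := hne
    have hdir : (affineSpan ℝ s).direction < ⊤ := by
      rw [lt_top_iff_ne_top]
      intro h
      refine hint (hs.interior_nonempty_iff_affineSpan_eq_top.2 ?_)
      exact (AffineSubspace.direction_eq_top_iff_of_nonempty
        ⟨y₀, subset_affineSpan ℝ s hy₀⟩).1 h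
    obtain ⟨g, hg, hle⟩ := Submodule.exists_le_ker_of_lt_top _ hdir
    have hconst : ∀ y ∈ s, g y = g y₀ := fun y hy => by
      have : y - y₀ ∈ (affineSpan ℝ s).direction :=
        AffineSubspace.vsub_mem_direction (subset_affineSpan ℝ s hy) (subset_affineSpan ℝ s hy₀)
      simpa [sub_eq_zero] using hle this
    have hg' : LinearMap.toContinuousLinearMap g ≠ 0 := by simpa using hg
    rcases le_total (g y₀) (g x) with h | h
    · exact ⟨LinearMap.toContinuousLinearMap g, hg', fun y hy => by simpa [hconst y hy] using h⟩
    · exact ⟨-LinearMap.toContinuousLinearMap g, neg_ne_zero.2 hg',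
        fun y hy => by simpa [hconst y hy] using h⟩

/-- In finite dimension, the mean of a function with respect to a probability measure belongs to the
convex hull of any set in which the function takes almost all its values. In contrast with
`Convex.integral_mem`, nothing is assumed closed. -/
theorem integral_mem_convexHull {α : Type*} [MeasurableSpace α] {ν : Measure α}
    [IsProbabilityMeasure ν] {E : Type*} [NormedAddCommGroup E] [NormedSpace ℝ E]
    [FiniteDimensional ℝ E] {F : α → E} {s : Set E} (hF : Integrable F ν)
    (hs : ∀ᵐ a ∂ν, F a ∈ s) : ∫ a, F a ∂ν ∈ convexHull ℝ s := by
  induction hn : finrank ℝ E using Nat.strong_induction_on generalizing E with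
  | _ n ih =>
  set m := ∫ a, F a ∂ν with hm
  by_contra hmem
  have hne : (convexHull ℝ s).Nonempty := by
    obtain ⟨a, ha⟩ := hs.exists
    exact ⟨F a, subset_convexHull ℝ s ha⟩
  obtain ⟨f, hf, hle⟩ := (convex_convexHull ℝ s).exists_ne_zero_forall_le_of_notMem hne hmem
  have hfF : Integrable (fun a => f (F a)) ν := f.integrable_comp hF
  have hker : ∀ᵐ a ∂ν, F a - m ∈ LinearMap.ker f.toLinearMap := by
    have hnonneg : 0 ≤ᵐ[ν] fun a => f m - f (F a) := by
      filter_upwards [hs] with a ha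
      simpa using hle _ (subset_convexHull ℝ s ha)
    have hzero : ∫ a, (f m - f (F a)) ∂ν = 0 := by
      rw [integral_sub (integrable_const _) hfF, f.integral_comp_comm hF]
      simp [hm]
    filter_upwards [(integral_eq_zero_iff_of_nonneg_ae hnonneg
      ((integrable_const _).sub hfF)).1 hzero] with a ha
    exact LinearMap.mem_ker.2 (by simpa [sub_eq_zero, eq_comm (a := f m)] using ha)
  obtain ⟨P, hP⟩ := f.ker_closedComplemented_of_finiteDimensional_range
  have hPF : ∀ᵐ a ∂ν, ((P (F a - m) : LinearMap.ker f.toLinearMap) : E) = F a - m := by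
    filter_upwards [hker] with a ha
    exact congrArg Subtype.val (hP ⟨_, ha⟩)
  have hFm : Integrable (fun a => F a - m) ν := hF.sub (integrable_const m)
  have hlt : finrank ℝ (LinearMap.ker f.toLinearMap) < n := by
    rw [← hn]
    refine Submodule.finrank_lt fun h => hf ?_
    ext y
    have : y ∈ LinearMap.ker f.toLinearMap := h ▸ Submodule.mem_top
    simpa using this
  have key := ih _ hlt (F := fun a => P (F a - m))
    (s := {y | (y : E) + m ∈ s}) (P.integrable_comp hFm)
    (by filter_upwards [hPF, hs] with a ha has
        rwa [ha, sub_add_cancel]) rfl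
  have hmean : ∫ a, P (F a - m) ∂ν = 0 := by
    rw [P.integral_comp_comm hFm, integral_sub hF (integrable_const m)]
    simp [hm]
  rw [hmean] at key
  let A : LinearMap.ker f.toLinearMap →ᵃ[ℝ] E :=
    (LinearMap.ker f.toLinearMap).subtype.toAffineMap + AffineMap.const ℝ _ m
  have himg : A 0 ∈ convexHull ℝ (A '' {y | (y : E) + m ∈ s}) := by
    rw [← A.image_convexHull]
    exact Set.mem_image_of_mem A key
  refine hmem (convexHull_mono (Set.image_subset_iff.2 fun y hy => ?_) (by simpa [A] using himg))
  simpa [A] using hy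

namespace Tchakaloff

variable {d : ℕ} {μ : Measure (Fin d → ℝ)} {m : ℕ}

theorem HasMomentsUpTo.mono {k : ℕ} (h : HasMomentsUpTo μ k) (hmk : m ≤ k) :
    HasMomentsUpTo μ m := fun p hp => h p (hp.trans hmk)

theorem HasMomentsUpTo.isFiniteMeasure (h : HasMomentsUpTo μ m) : IsFiniteMeasure μ := by
  have h1 := h 1 (by simp)
  simp only [map_one] at h1
  exact (integrable_const_iff_isFiniteMeasure one_ne_zero).1 h1

/-- Restrictions to the support have a coordinate system given by `dimOnSupport μ m` polynomials:
on the support every polynomial of degree at most `m` is a linear function of those. -/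
theorem exists_coordinates (μ : Measure (Fin d → ℝ)) (m : ℕ) :
    ∃ P : Fin (dimOnSupport μ m) → MvPolynomial (Fin d) ℝ, (∀ i, (P i).totalDegree ≤ m) ∧
      ∀ p : MvPolynomial (Fin d) ℝ, p.totalDegree ≤ m →
        ∃ c : Fin (dimOnSupport μ m) → ℝ, ∀ t ∈ μ.support,
          MvPolynomial.eval t p = ∑ i, c i * MvPolynomial.eval t (P i) := by
  let b : Basis (Fin (dimOnSupport μ m)) ℝ (polyOnSupport μ m) := finBasis ℝ (polyOnSupport μ m)
  choose P hPdeg hP using fun i => Submodule.mem_map.1 (b i).2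
  refine ⟨P, fun i => (MvPolynomial.mem_restrictTotalDegree _ _ _).1 (hPdeg i), fun p hp => ?_⟩
  let q : polyOnSupport μ m := ⟨restrictTo μ.support p,
    Submodule.mem_map_of_mem ((MvPolynomial.mem_restrictTotalDegree _ _ _).2 hp)⟩
  refine ⟨b.repr q, fun t ht => ?_⟩
  have h := congrFun (congrArg Subtype.val (b.sum_repr q)) ⟨t, ht⟩
  simp only [Submodule.coe_sum, Submodule.coe_smul, Finset.sum_apply, Pi.smul_apply, ← hP,
    smul_eq_mul] at h
  exact h.symm

theorem HasMomentsUpTo.exists_isQuadratureRule (h : HasMomentsUpTo μ m) :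
    ∃ N : ℕ, N ≤ 1 + dimOnSupport μ m ∧
      ∃ (x : Fin N → (Fin d → ℝ)) (ρ : Fin N → ℝ), IsQuadratureRule μ m x ρ := by
  have := h.isFiniteMeasure
  rcases eq_or_ne μ 0 with rfl | hμ0
  · exact ⟨0, Nat.zero_le _, Fin.elim0, Fin.elim0, h, fun k => k.elim0, fun k => k.elim0, by simp⟩
  have : NeZero μ := ⟨hμ0⟩
  obtain ⟨P, hPdeg, hP⟩ := exists_coordinates μ m
  let F : (Fin d → ℝ) → (Fin (dimOnSupport μ m) → ℝ) := fun t i => MvPolynomial.eval t (P i)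
  have hPint : ∀ i, Integrable (fun t => MvPolynomial.eval t (P i)) μ := fun i => h _ (hPdeg i)
  have hF : Integrable F μ := Integrable.of_eval hPint
  have hsupp : ∀ᵐ t ∂μ, t ∈ μ.support := Measure.support_mem_ae
  have hmass : 0 < μ.real Set.univ := by simp
  have hmem : ⨍ t, F t ∂μ ∈ convexHull ℝ (F '' μ.support) :=
    integral_mem_convexHull (hF.smul_measure (by simp [hμ0]))
      (Measure.ae_smul_measure (hsupp.mono fun t ht => Set.mem_image_of_mem F ht) _)
  obtain ⟨ι, _, z, w, hz, hind, hw, -, hsum⟩ := eq_pos_convex_span_of_mem_convexHull hmem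
  choose x hx hxz using fun k => hz (Set.mem_range_self k)
  let e := (Fintype.equivFin ι).symm
  refine ⟨Fintype.card ι, ?_, fun k => x (e k), fun k => μ.real Set.univ * w (e k),
    h, fun k => hx _, fun k => mul_pos hmass (hw _), fun p hp => ?_⟩
  · have h1 := hind.card_le_finrank_succ
    have h2 := (vectorSpan ℝ (Set.range z)).finrank_le
    rw [finrank_fin_fun] at h2
    omega
  obtain ⟨c, hc⟩ := hP p hp
  -- The coordinates of the average of `F`, multiplied by the total mass.
  have hcoord : ∀ i, ∫ t, MvPolynomial.eval t (P i) ∂μ =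
      ∑ k, μ.real Set.univ * w k * MvPolynomial.eval (x k) (P i) := fun i => by
    have h1 := congrFun (congrArg (μ.real Set.univ • ·) hsum) i
    rw [measure_smul_average, eval_integral hPint] at h1
    simpa [F, ← hxz, Finset.mul_sum, mul_assoc] using h1.symm
  calc ∫ t, MvPolynomial.eval t p ∂μ
      = ∫ t, ∑ i, c i * MvPolynomial.eval t (P i) ∂μ :=
        integral_congr_ae (hsupp.mono fun t ht => hc t ht)
    _ = ∑ i, c i * ∫ t, MvPolynomial.eval t (P i) ∂μ := by
        rw [integral_finsetSum _ fun i _ => (hPint i).const_mul _]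
        simp only [integral_const_mul]
    _ = ∑ k, μ.real Set.univ * w k * MvPolynomial.eval (x k) p := by
        simp only [hcoord, hc _ (hx _), Finset.mul_sum]
        rw [Finset.sum_comm]
        exact Finset.sum_congr rfl fun k _ => Finset.sum_congr rfl fun i _ => by ring
    _ = _ := (e.sum_comp fun k => μ.real Set.univ * w k * MvPolynomial.eval (x k) p).symm

end Tchakaloff

theorem theorem1p3 (d n : ℕ) (hn : 1 ≤ n) (μ : Measure (Fin d → ℝ))
    (hμ : Tchakaloff.HasMomentsUpTo μ n) :
    ∃ N : ℕ, N ≤ 1 + Tchakaloff.dimOnSupport μ (n - 1) ∧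
      ∃ (x : Fin N → (Fin d → ℝ)) (ρ : Fin N → ℝ),
        Tchakaloff.IsQuadratureRule μ (n - 1) x ρ :=
  (hμ.mono (Nat.sub_le n 1)).exists_isQuadratureRule
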